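/- Consider the linear system $x_{k+1} = A x_k + B u_k + w_k$, $x_0 = 0$, with $x_k \in \mathbb{R}^n$, $u_k \in \mathbb{R}^m$, where the noise vectors $w_0, w_1, \ldots$ are independent and identically distributed with $\mathbb{E} w_k = 0$, $\mathbb{E}(w_k w_k^T) = W \succ 0$ and finite fourth moment $\mathbb{E}\|w_k\|^4 = \mu_4$. Let $Q \succ 0$ and $R \succ 0$ be fixed weight matrices; the cost of a controller is $$J = \limsup_{T\to\infty} \frac1T\, \mathbb{E}\left[\sum_{k=0}^{T-1} \left(x_k^T Q x_k + u_k^T R u_k\right)\right].$$ Let the gains $K_0$ and $K_1$ both be stabilizing, i.e. $A+BK_0$ and $A+BK_1$ have spectral radius less than $1$. Let $J^{K_1}$ be the cost of the linear controller $u_k = K_1 x_k$. For a threshold $M > 0$ and a dwell time $t \in \mathbb{N}$, let $J^{K_1,M,t}$ be the cost of the following switched controller, which keeps a counter $\xi_k \in \mathbb{N}$ with $\xi_0 = 0$: if $\xi_k > 0$, then $u_k = K_0 x_k$ and $\xi_{k+1} = \xi_k - 1$; if $\xi_k = 0$ and $\|(K_1 - K_0) x_k\| \ge M$, then $u_k =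 K_0 x_k$ and $\xi_{k+1} = \max\{t - 1, 0\}$; if $\xi_k = 0$ and $\|(K_1 - K_0) x_k\| < M$, then $u_k = K_1 x_k$ and $\xi_{k+1} = 0$. Then, with $A, B, Q, R, K_0, K_1$ and the noise distribution held constant and $M, t$ varied, $J^{K_1}$ is finite, $J^{K_1,M,t}$ is eventually finite, and $$J^{K_1,M,t} - J^{K_1} = O\!\left(t^{1/4}/M\right)$$ as $M \to \infty$, $t \to \infty$, $t^{1/4}/M \to 0$. -/

import Mathlib

open MeasureTheory ProbabilityTheory Filter Topology Asymptotics
open scoped ENNReal Matrix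

noncomputable section

/-- The matrix-vector product on Euclidean spaces. -/
def mulVecE {p q : ℕ} (K : Matrix (Fin p) (Fin q) ℝ) (x : EuclideanSpace ℝ (Fin q)) :
    EuclideanSpace ℝ (Fin p) :=
  WithLp.toLp 2 (K *ᵥ x.ofLp)

/-- The quadratic form `xᵀ Q x`. -/
def quadForm {n : ℕ} (Q : Matrix (Fin n) (Fin n) ℝ) (x : EuclideanSpace ℝ (Fin n)) : ℝ :=
  x.ofLp ⬝ᵥ (Q *ᵥ x.ofLp)

/-- A real square matrix is stable (in discrete time) if its spectral radius, i.e. the largest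
modulus of its complex eigenvalues, is less than one. -/
def IsSchurStable {n : ℕ} (F : Matrix (Fin n) (Fin n) ℝ) : Prop :=
  spectralRadius ℂ (F.map Complex.ofReal) < 1

/-- One call of the switched control strategy: given the current state `x` and the current
counter `ξ`, returns the control input and the next counter value. The truncated
subtraction `ξ - 1` on `ℕ` is `max {ξ - 1, 0}`. -/
def switchedControl {n m : ℕ} (K₀ K₁ : Matrix (Fin m) (Fin n) ℝ) (M : ℝ) (t : ℕ)
    (x : EuclideanSpace ℝ (Fin n)) (ξ : ℕ) : EuclideanSpace ℝ (Fin m) × ℕ :=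
  if 0 < ξ then (mulVecE K₀ x, ξ - 1)
  else if M ≤ ‖mulVecE (K₁ - K₀) x‖ then (mulVecE K₀ x, t - 1)
  else (mulVecE K₁ x, 0)

/-- State and counter at time `k` of the closed loop `x_{k+1} = A x_k + B u_k + w_k` under the
switched control strategy, started from `x_0 = 0` and counter value `0`, for a given noise
realization `w`. -/
def switchedLoop {n m : ℕ} (A : Matrix (Fin n) (Fin n) ℝ) (B : Matrix (Fin n) (Fin m) ℝ)
    (K₀ K₁ : Matrix (Fin m) (Fin n) ℝ) (M : ℝ) (t : ℕ) (w : ℕ → EuclideanSpace ℝ (Fin n)) :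
    ℕ → EuclideanSpace ℝ (Fin n) × ℕ
  | 0 => (0, 0)
  | k + 1 =>
    let s := switchedLoop A B K₀ K₁ M t w k
    let c := switchedControl K₀ K₁ M t s.1 s.2
    (mulVecE A s.1 + mulVecE B c.1 + w k, c.2)

/-- The input applied at time `k` in the switched closed loop. -/
def switchedInput {n m : ℕ} (A : Matrix (Fin n) (Fin n) ℝ) (B : Matrix (Fin n) (Fin m) ℝ)
    (K₀ K₁ : Matrix (Fin m) (Fin n) ℝ) (M : ℝ) (t : ℕ) (w : ℕ → EuclideanSpace ℝ (Fin n))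
    (k : ℕ) : EuclideanSpace ℝ (Fin m) :=
  (switchedControl K₀ K₁ M t (switchedLoop A B K₀ K₁ M t w k).1
    (switchedLoop A B K₀ K₁ M t w k).2).1

/-- The state at time `k` of `x_{k+1} = A x_k + B u_k + w_k`, `x_0 = 0`, under the linear
controller `u = K x`. -/
def linearLoop {n m : ℕ} (A : Matrix (Fin n) (Fin n) ℝ) (B : Matrix (Fin n) (Fin m) ℝ)
    (K : Matrix (Fin m) (Fin n) ℝ) (w : ℕ → EuclideanSpace ℝ (Fin n)) :
    ℕ → EuclideanSpace ℝ (Fin n)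
  | 0 => 0
  | k + 1 =>
    mulVecE A (linearLoop A B K w k) + mulVecE B (mulVecE K (linearLoop A B K w k)) + w k

/-- The infinite-horizon quadratic cost
`limsup_{T → ∞} (1 / T) 𝔼 [∑_{k < T} (x_kᵀ Q x_k + u_kᵀ R u_k)]` of a state process `x` and an
input process `u`, as an extended nonnegative number (the weights `Q`, `R` are positive definite
wherever this is used, so the sum is nonnegative). -/
def lqCost {n m : ℕ} {Ω : Type*} [MeasurableSpace Ω] (μ : Measure Ω)
    (Q : Matrix (Fin n) (Fin n) ℝ) (R : Matrix (Fin m) (Fin m) ℝ)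
    (x : ℕ → Ω → EuclideanSpace ℝ (Fin n)) (u : ℕ → Ω → EuclideanSpace ℝ (Fin m)) : ℝ≥0∞ :=
  limsup (fun T : ℕ => (T : ℝ≥0∞)⁻¹ *
    ∫⁻ ω, ENNReal.ofReal (∑ k ∈ Finset.range T, (quadForm Q (x k ω) + quadForm R (u k ω))) ∂μ)
    atTop

/-- The cost `J^{K₁,M,t}` of the switched closed loop driven by the noise process `w`. -/
def switchedCost {n m : ℕ} {Ω : Type*} [MeasurableSpace Ω] (μ : Measure Ω)
    (A : Matrix (Fin n) (Fin n) ℝ) (B : Matrix (Fin n) (Fin m) ℝ)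
    (Q : Matrix (Fin n) (Fin n) ℝ) (R : Matrix (Fin m) (Fin m) ℝ)
    (K₀ K₁ : Matrix (Fin m) (Fin n) ℝ) (w : ℕ → Ω → EuclideanSpace ℝ (Fin n))
    (M : ℝ) (t : ℕ) : ℝ≥0∞ :=
  lqCost μ Q R (fun k ω => (switchedLoop A B K₀ K₁ M t (fun i => w i ω) k).1)
    (fun k ω => switchedInput A B K₀ K₁ M t (fun i => w i ω) k)

/-- The cost `J^K` of the closed loop under the linear controller `u = K x`. -/
def linearCost {n m : ℕ} {Ω : Type*} [MeasurableSpace Ω] (μ : Measure Ω)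
    (A : Matrix (Fin n) (Fin n) ℝ) (B : Matrix (Fin n) (Fin m) ℝ)
    (Q : Matrix (Fin n) (Fin n) ℝ) (R : Matrix (Fin m) (Fin m) ℝ)
    (K : Matrix (Fin m) (Fin n) ℝ) (w : ℕ → Ω → EuclideanSpace ℝ (Fin n)) : ℝ≥0∞ :=
  lqCost μ Q R (fun k ω => linearLoop A B K (fun i => w i ω) k)
    (fun k ω => mulVecE K (linearLoop A B K (fun i => w i ω) k))

/-- The random vectors `w_k` are independent and identically distributed with
`𝔼 w_k = 0`, `𝔼 (w_k w_kᵀ) = W` and finite fourth moment `𝔼 ‖w_k‖⁴ = μ₄`. -/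
structure IsNoise {n : ℕ} {Ω : Type*} [MeasurableSpace Ω] (μ : Measure Ω)
    (w : ℕ → Ω → EuclideanSpace ℝ (Fin n)) (W : Matrix (Fin n) (Fin n) ℝ) (μ₄ : ℝ) : Prop where
  measurable : ∀ k, Measurable (w k)
  indep : iIndepFun w μ
  identDistrib : ∀ k, IdentDistrib (w k) (w 0) μ μ
  mean : ∀ k, ∫ ω, w k ω ∂μ = 0
  covariance : ∀ k i j, ∫ ω, w k ω i * w k ω j ∂μ = W i j
  memLp : ∀ k, MemLp (w k) 4 μ
  fourthMoment : ∀ k, ∫ ω, ‖w k ω‖ ^ 4 ∂μ = μ₄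

/-- The regime `M → ∞`, `t → ∞`, `t^{1/4} / M → 0` for pairs `(M, t)`. -/
def thresholdDwellRegime : Filter (ℝ × ℕ) :=
  (atTop ×ˢ atTop) ⊓ comap (fun p : ℝ × ℕ => (p.2 : ℝ) ^ (1 / 4 : ℝ) / p.1) (𝓝 0)

end

/-! Write ε = t^(1/4)/M. The proof compares the two loops path by path, driven by the same noise,
and takes expectations only at the end.

Uniform stability. In suitable norms both closed loops contract. Changing norms at a switch costs a
bounded factor, which a long enough dwell under `K₀` pays back. A Lyapunov function of state and
counter expresses this (`lyapunov_step_le`). Hence, for all large t and every M, the switched state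
is at most L d_k, where d is a stable scalar filter of the noise norms
(`exists_norm_switchedLoop_le`). The fourth moments of d_k are bounded uniformly in k.

Rare fallback. If `K₀` acts at time k, then d_j ≥ M/a for some j among the last t times, with a a
fixed constant. On that event d_k² ≤ ε² d_k⁴ + ε⁻², and the indicator of the event is at most (a/M)⁴
∑ d_j⁴ (`sq_le_excursionBound`). Up to constants the mean is at most ε² + ε⁻² t/M⁴ = 2ε². The input
deviation is therefore O(ε²) in mean square, and so is the state deviation, which is a stable
response to it.

Cost. A quadratic cost changes by at most a multiple of (deviation) × (size), and Young's inequality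
bounds this product by ε⁻¹ (deviation)² + ε (size)². Its mean is O(ε), uniformly in time, so the
averaged costs differ by O(ε). -/

section

open scoped Matrix.Norms.L2Operator

/-! ### Matrix-vector products and quadratic forms in the Euclidean norm -/

section MulVecE

variable {p q r : ℕ}

theorem mulVecE_add (K : Matrix (Fin p) (Fin q) ℝ) (x y : EuclideanSpace ℝ (Fin q)) :
    mulVecE K (x + y) = mulVecE K x + mulVecE K y := by
  simp [mulVecE, Matrix.mulVec_add]

theorem mulVecE_sub (K : Matrix (Fin p) (Fin q) ℝ) (x y : EuclideanSpace ℝ (Fin q)) :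
    mulVecE K (x - y) = mulVecE K x - mulVecE K y := by
  simp [mulVecE, Matrix.mulVec_sub]

theorem add_mulVecE (K L : Matrix (Fin p) (Fin q) ℝ) (x : EuclideanSpace ℝ (Fin q)) :
    mulVecE (K + L) x = mulVecE K x + mulVecE L x := by
  simp [mulVecE, Matrix.add_mulVec]

theorem sub_mulVecE (K L : Matrix (Fin p) (Fin q) ℝ) (x : EuclideanSpace ℝ (Fin q)) :
    mulVecE (K - L) x = mulVecE K x - mulVecE L x := by
  simp [mulVecE, Matrix.sub_mulVec]

theorem mul_mulVecE (K : Matrix (Fin p) (Fin q) ℝ) (L : Matrix (Fin q) (Fin r) ℝ)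
    (x : EuclideanSpace ℝ (Fin r)) : mulVecE (K * L) x = mulVecE K (mulVecE L x) := by
  simp [mulVecE]

theorem one_mulVecE (x : EuclideanSpace ℝ (Fin p)) : mulVecE 1 x = x := by
  simp [mulVecE]

theorem norm_mulVecE_le (K : Matrix (Fin p) (Fin q) ℝ) (x : EuclideanSpace ℝ (Fin q)) :
    ‖mulVecE K x‖ ≤ ‖K‖ * ‖x‖ :=
  Matrix.l2_opNorm_mulVec K x

end MulVecE

theorem quadForm_eq_inner {n : ℕ} (Q : Matrix (Fin n) (Fin n) ℝ) (x : EuclideanSpace ℝ (Fin n)) :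
    quadForm Q x = inner ℝ (mulVecE Q x) x := by
  simp [quadForm, mulVecE, PiLp.inner_apply, dotProduct]

theorem abs_quadForm_sub_le {n : ℕ} (Q : Matrix (Fin n) (Fin n) ℝ)
    (x y : EuclideanSpace ℝ (Fin n)) :
    |quadForm Q x - quadForm Q y| ≤ ‖Q‖ * (‖x - y‖ * (‖x‖ + ‖y‖)) := by
  have h : quadForm Q x - quadForm Q y
      = inner ℝ (mulVecE Q (x - y)) x + inner ℝ (mulVecE Q y) (x - y) := by
    rw [quadForm_eq_inner, quadForm_eq_inner, mulVecE_sub, inner_sub_left, inner_sub_right]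
    ring
  rw [h]
  refine (abs_add_le _ _).trans ?_
  have h1 := (abs_real_inner_le_norm (mulVecE Q (x - y)) x).trans
    (mul_le_mul_of_nonneg_right (norm_mulVecE_le Q (x - y)) (norm_nonneg x))
  have h2 := (abs_real_inner_le_norm (mulVecE Q y) (x - y)).trans
    (mul_le_mul_of_nonneg_right (norm_mulVecE_le Q y) (norm_nonneg (x - y)))
  linarith

theorem quadForm_zero {n : ℕ} (Q : Matrix (Fin n) (Fin n) ℝ) : quadForm Q 0 = 0 := by
  simp [quadForm]

/-! ### Schur stability and adapted norms -/

theorem norm_mulVecE_le_map_ofReal {n : ℕ} (F : Matrix (Fin n) (Fin n) ℝ)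
    (x : EuclideanSpace ℝ (Fin n)) : ‖mulVecE F x‖ ≤ ‖F.map Complex.ofReal‖ * ‖x‖ := by
  have key (y : EuclideanSpace ℝ (Fin n)) :
      ‖(WithLp.toLp 2 (fun i => (y i : ℂ)) : EuclideanSpace ℂ (Fin n))‖ = ‖y‖ := by
    simp [EuclideanSpace.norm_eq]
  have h := Matrix.l2_opNorm_mulVec (F.map Complex.ofReal)
    (WithLp.toLp 2 (fun i => (x i : ℂ)) : EuclideanSpace ℂ (Fin n))
  rw [key] at h
  rw [← key (mulVecE F x)]
  refine le_trans (le_of_eq ?_) h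
  congr 1
  ext i
  simp [mulVecE, Matrix.mulVec, dotProduct]

/-- Some power of a Schur stable matrix is a contraction. -/
theorem IsSchurStable.exists_pow_contraction {n : ℕ} {F : Matrix (Fin n) (Fin n) ℝ}
    (hF : IsSchurStable F) : ∃ ρ : ℝ, 0 < ρ ∧ ρ < 1 ∧ ∃ N : ℕ, 1 ≤ N ∧
      ∀ x, ‖mulVecE (F ^ N) x‖ ≤ ρ ^ N * ‖x‖ := by
  obtain ⟨ρ, h1, h2⟩ := ENNReal.lt_iff_exists_nnreal_btwn.1 hF
  have hρ : (ρ : ℝ) < 1 := by exact_mod_cast h2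
  have hρ0 : (0 : ℝ) < ρ := by
    have : (0 : ℝ≥0∞) < ρ := lt_of_le_of_lt zero_le h1
    exact_mod_cast this
  -- Gelfand's formula, applied over ℂ, where the spectral radius is defined; the embedding of ℝⁿ
  -- into ℂⁿ is isometric, so the bound descends to real vectors.
  have ht := spectrum.pow_nnnorm_pow_one_div_tendsto_nhds_spectralRadius (F.map Complex.ofReal)
  obtain ⟨N, hN, hN1⟩ := ((ht.eventually_lt_const h1).and (eventually_ge_atTop 1)).exists
  refine ⟨ρ, hρ0, hρ, N, hN1, fun x => ?_⟩
  have hmap : (F ^ N).map Complex.ofReal = (F.map Complex.ofReal) ^ N :=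
    map_pow (Complex.ofRealHom.mapMatrix) F N
  refine (norm_mulVecE_le_map_ofReal _ x).trans ?_
  rw [hmap]
  gcongr
  have hlt := ENNReal.rpow_le_rpow hN.le (Nat.cast_nonneg N : (0 : ℝ) ≤ N)
  rw [← ENNReal.rpow_mul, one_div_mul_cancel (by positivity), ENNReal.rpow_one,
    ENNReal.rpow_natCast] at hlt
  exact_mod_cast hlt

/-- A Schur stable matrix is a strict contraction in a suitable norm. -/
theorem IsSchurStable.exists_adapted_norm {n : ℕ} {F : Matrix (Fin n) (Fin n) ℝ}
    (hF : IsSchurStable F) : ∃ ρ : ℝ, 0 < ρ ∧ ρ < 1 ∧ ∃ C : ℝ,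
      ∃ p : EuclideanSpace ℝ (Fin n) → ℝ, (∀ x y, p (x + y) ≤ p x + p y) ∧
        (∀ x, ‖x‖ ≤ p x) ∧ (∀ x, p x ≤ C * ‖x‖) ∧ ∀ x, p (mulVecE F x) ≤ ρ * p x := by
  obtain ⟨ρ, h0, h1, N, hN, hc⟩ := hF.exists_pow_contraction
  -- In the norm ∑_{j<N} ρ^(-j) ‖F^j x‖, applying F shifts the sum: a factor ρ comes out, and the
  -- term ‖x‖ is replaced by ρ^(-N) ‖F^N x‖, which is no larger.
  refine ⟨ρ, h0, h1, ∑ j ∈ Finset.range N, (ρ ^ j)⁻¹ * ‖F ^ j‖,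
    fun x => ∑ j ∈ Finset.range N, (ρ ^ j)⁻¹ * ‖mulVecE (F ^ j) x‖, ?_, ?_, ?_, ?_⟩
  · intro x y
    rw [← Finset.sum_add_distrib]
    refine Finset.sum_le_sum fun j _ => ?_
    rw [mulVecE_add, ← mul_add]
    gcongr
    exact norm_add_le _ _
  · intro x
    have := Finset.single_le_sum (f := fun j => (ρ ^ j)⁻¹ * ‖mulVecE (F ^ j) x‖)
      (fun j _ => by positivity) (Finset.mem_range.2 hN)
    simpa [one_mulVecE] using this
  · intro x
    rw [Finset.sum_mul]
    refine Finset.sum_le_sum fun j _ => ?_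
    rw [mul_assoc]
    gcongr
    exact norm_mulVecE_le _ _
  · intro x
    have hs : ∑ j ∈ Finset.range N, (ρ ^ j)⁻¹ * ‖mulVecE (F ^ j) (mulVecE F x)‖
        = ρ * ∑ j ∈ Finset.range N, (ρ ^ (j + 1))⁻¹ * ‖mulVecE (F ^ (j + 1)) x‖ := by
      rw [Finset.mul_sum]
      refine Finset.sum_congr rfl fun j _ => ?_
      rw [← mul_mulVecE, ← pow_succ, pow_succ ρ]
      field_simp
    simp only [hs]
    have hsum := (Finset.sum_range_succ (fun j => (ρ ^ j)⁻¹ * ‖mulVecE (F ^ j) x‖) N).symm.trans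
      (Finset.sum_range_succ' (fun j => (ρ ^ j)⁻¹ * ‖mulVecE (F ^ j) x‖) N)
    have hlast : (ρ ^ N)⁻¹ * ‖mulVecE (F ^ N) x‖ ≤ ‖x‖ := by
      rw [inv_mul_le_iff₀ (by positivity)]
      exact hc x
    simp only [pow_zero, inv_one, one_mul, one_mulVecE] at hsum
    refine mul_le_mul_of_nonneg_left ?_ h0.le
    linarith

/-! ### Scalar filters and convexity inequalities -/

/-- The response of the scalar filter `s_{k+1} = c s_k + a_k`, `s_0 = 0`. -/
def geomFilter (c : ℝ) (a : ℕ → ℝ) : ℕ → ℝ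
  | 0 => 0
  | k + 1 => c * geomFilter c a k + a k

section GeomFilter

variable {c : ℝ} {a : ℕ → ℝ}

theorem geomFilter_nonneg (hc : 0 ≤ c) (ha : ∀ k, 0 ≤ a k) (k : ℕ) : 0 ≤ geomFilter c a k := by
  induction k with
  | zero => exact le_rfl
  | succ k ih => exact add_nonneg (mul_nonneg hc ih) (ha k)

/-- A sequence with `s_{k+1} ≤ c s_k + L a_k` is dominated by the filter response. -/
theorem le_mul_geomFilter {s : ℕ → ℝ} {L : ℝ} (hc : 0 ≤ c) (h0 : s 0 ≤ 0)
    (hs : ∀ k, s (k + 1) ≤ c * s k + L * a k) (k : ℕ) : s k ≤ L * geomFilter c a k := by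
  induction k with
  | zero => simpa [geomFilter] using h0
  | succ k ih =>
    have := mul_le_mul_of_nonneg_left ih hc
    have := hs k
    simp only [geomFilter]
    linarith

/-- Convexity of the square at c x + (1 - c) (y / (1 - c)). The coefficient of x² is still c, so the
square of a filtered quantity obeys a filter recursion with the same decay; applying the inequality
twice does the same for fourth powers. -/
theorem sq_add_le (hc0 : 0 < c) (hc : c < 1) (x y : ℝ) :
    (c * x + y) ^ 2 ≤ c * x ^ 2 + (1 - c)⁻¹ * y ^ 2 := by
  have h : 0 < 1 - c := by linarith
  have h2 : (1 - c) * ((1 - c)⁻¹ * y ^ 2) = y ^ 2 := by field_simp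
  have h3 : 0 ≤ c * (((1 - c) * x - y) ^ 2) := by positivity
  have : (1 - c) * (c * x + y) ^ 2 ≤ (1 - c) * (c * x ^ 2 + (1 - c)⁻¹ * y ^ 2) := by
    rw [mul_add, h2]
    nlinarith
  exact le_of_mul_le_mul_left this h

theorem pow_four_add_le (hc0 : 0 < c) (hc : c < 1) (x y : ℝ) :
    (c * x + y) ^ 4 ≤ c * x ^ 4 + ((1 - c)⁻¹) ^ 3 * y ^ 4 := by
  have h1 := sq_add_le hc0 hc x y
  have h2 := sq_add_le hc0 hc (x ^ 2) ((1 - c)⁻¹ * y ^ 2)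
  have h3 := pow_le_pow_left₀ (sq_nonneg _) h1 2
  calc (c * x + y) ^ 4 = ((c * x + y) ^ 2) ^ 2 := by ring
    _ ≤ _ := h3
    _ ≤ _ := h2
    _ = _ := by ring

end GeomFilter

/-! ### The switched loop and its triggers -/

section ClosedLoop

variable {n m : ℕ} (A : Matrix (Fin n) (Fin n) ℝ) (B : Matrix (Fin n) (Fin m) ℝ)
  (K₀ K₁ : Matrix (Fin m) (Fin n) ℝ) (M : ℝ) (t : ℕ)

theorem switchedLoop_succ_fst (w : ℕ → EuclideanSpace ℝ (Fin n)) (k : ℕ) :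
    (switchedLoop A B K₀ K₁ M t w (k + 1)).1 = mulVecE A (switchedLoop A B K₀ K₁ M t w k).1
      + mulVecE B (switchedInput A B K₀ K₁ M t w k) + w k := rfl

theorem switchedLoop_succ_snd (w : ℕ → EuclideanSpace ℝ (Fin n)) (k : ℕ) :
    (switchedLoop A B K₀ K₁ M t w (k + 1)).2 =
      (switchedControl K₀ K₁ M t (switchedLoop A B K₀ K₁ M t w k).1
        (switchedLoop A B K₀ K₁ M t w k).2).2 := rfl

theorem switchedLoop_succ (w : ℕ → EuclideanSpace ℝ (Fin n)) (k : ℕ) :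
    switchedLoop A B K₀ K₁ M t w (k + 1) =
      (mulVecE A (switchedLoop A B K₀ K₁ M t w k).1
        + mulVecE B (switchedControl K₀ K₁ M t (switchedLoop A B K₀ K₁ M t w k).1
        (switchedLoop A B K₀ K₁ M t w k).2).1 + w k,
      (switchedControl K₀ K₁ M t (switchedLoop A B K₀ K₁ M t w k).1
        (switchedLoop A B K₀ K₁ M t w k).2).2) := rfl

theorem mulVecE_closedLoop (K : Matrix (Fin m) (Fin n) ℝ) (x : EuclideanSpace ℝ (Fin n)) :
    mulVecE (A + B * K) x = mulVecE A x + mulVecE B (mulVecE K x) := by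
  rw [add_mulVecE, mul_mulVecE]

/-- The fallback gain `K₀` is in use at time `k` of the switched loop. -/
def IsFallback (w : ℕ → EuclideanSpace ℝ (Fin n)) (k : ℕ) : Prop :=
  0 < (switchedLoop A B K₀ K₁ M t w k).2 ∨
    M ≤ ‖mulVecE (K₁ - K₀) (switchedLoop A B K₀ K₁ M t w k).1‖

variable {A B K₀ K₁ M t}

theorem switchedInput_of_isFallback {w : ℕ → EuclideanSpace ℝ (Fin n)} {k : ℕ}
    (h : IsFallback A B K₀ K₁ M t w k) : switchedInput A B K₀ K₁ M t w k
      = mulVecE K₀ (switchedLoop A B K₀ K₁ M t w k).1 := by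
  unfold switchedInput switchedControl
  unfold IsFallback at h
  split_ifs with h1 h2
  · rfl
  · rfl
  · tauto

theorem switchedInput_of_not_isFallback {w : ℕ → EuclideanSpace ℝ (Fin n)} {k : ℕ}
    (h : ¬ IsFallback A B K₀ K₁ M t w k) : switchedInput A B K₀ K₁ M t w k
      = mulVecE K₁ (switchedLoop A B K₀ K₁ M t w k).1 := by
  unfold switchedInput switchedControl
  unfold IsFallback at h
  split_ifs with h1 h2
  · tauto
  · tauto
  · rfl

/-- While the counter runs, time plus counter is conserved; a trigger at j restarts it at (j + 1) +
(t - 1) = j + t. -/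
theorem exists_trigger_of_counter_pos (ht : 1 ≤ t) (w : ℕ → EuclideanSpace ℝ (Fin n)) (k : ℕ)
    (h : 0 < (switchedLoop A B K₀ K₁ M t w k).2) :
    ∃ j < k, k + (switchedLoop A B K₀ K₁ M t w k).2 ≤ j + t ∧
      M ≤ ‖mulVecE (K₁ - K₀) (switchedLoop A B K₀ K₁ M t w j).1‖ := by
  induction k with
  | zero => simp [switchedLoop] at h
  | succ k ih =>
    rw [switchedLoop_succ_snd] at h ⊢
    unfold switchedControl at h ⊢
    split_ifs at h ⊢ with h1 h2
    · obtain ⟨j, hj, h3, h4⟩ := ih h1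
      exact ⟨j, by omega, by simp only at h ⊢; omega, h4⟩
    · exact ⟨k, by omega, by simp only at h ⊢; omega, h2⟩
    · simp at h

/-- While the fallback gain is used, the last trigger is less than `t` steps old. -/
theorem IsFallback.exists_trigger (ht : 1 ≤ t) {w : ℕ → EuclideanSpace ℝ (Fin n)} {k : ℕ}
    (h : IsFallback A B K₀ K₁ M t w k) : ∃ j ∈ Finset.Ico (k + 1 - t) (k + 1),
      M ≤ ‖mulVecE (K₁ - K₀) (switchedLoop A B K₀ K₁ M t w j).1‖ := by
  rcases h with h | h
  · obtain ⟨j, h1, h2, h3⟩ := exists_trigger_of_counter_pos ht w k h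
    exact ⟨j, by rw [Finset.mem_Ico]; omega, h3⟩
  · exact ⟨k, by rw [Finset.mem_Ico]; omega, h⟩

end ClosedLoop

/-! ### A Lyapunov function for the switched loop -/

/-- The two closed-loop matrices are strict contractions with a common factor `lam ^ 2` in norms
`p₀`, `p₁` that are equivalent to the Euclidean norm. -/
structure AdaptedNorms {n : ℕ} (F₀ F₁ : Matrix (Fin n) (Fin n) ℝ) (lam C : ℝ)
    (p₀ p₁ : EuclideanSpace ℝ (Fin n) → ℝ) : Prop where
  pos : 0 < lam
  lt_one : lam < 1
  one_le : 1 ≤ C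
  add₀ : ∀ x y, p₀ (x + y) ≤ p₀ x + p₀ y
  add₁ : ∀ x y, p₁ (x + y) ≤ p₁ x + p₁ y
  norm_le₀ : ∀ x, ‖x‖ ≤ p₀ x
  norm_le₁ : ∀ x, ‖x‖ ≤ p₁ x
  le_norm₀ : ∀ x, p₀ x ≤ C * ‖x‖
  le_norm₁ : ∀ x, p₁ x ≤ C * ‖x‖
  contract₀ : ∀ x, p₀ (mulVecE F₀ x) ≤ lam * lam * p₀ x
  contract₁ : ∀ x, p₁ (mulVecE F₁ x) ≤ lam * lam * p₁ x

theorem exists_adaptedNorms {n : ℕ} {F₀ F₁ : Matrix (Fin n) (Fin n) ℝ}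
    (h₀ : IsSchurStable F₀) (h₁ : IsSchurStable F₁) :
    ∃ lam C p₀ p₁, AdaptedNorms F₀ F₁ lam C p₀ p₁ := by
  obtain ⟨r₀, hr₀, hr₀', C₀, p₀, a1, a2, a3, a4⟩ := h₀.exists_adapted_norm
  obtain ⟨r₁, hr₁, hr₁', C₁, p₁, b1, b2, b3, b4⟩ := h₁.exists_adapted_norm
  have hmax : 0 < max r₀ r₁ := lt_max_of_lt_left hr₀
  -- The square root splits the common contraction factor into two: one factor `lam` pays for the
  -- changing weight in `lyapunov`, the other remains as decay.
  refine ⟨√(max r₀ r₁), max 1 (max C₀ C₁), p₀, p₁, ?_, ?_, le_max_left _ _, a1, b1, a2, b2,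
    fun x => (a3 x).trans ?_, fun x => (b3 x).trans ?_, fun x => (a4 x).trans ?_,
    fun x => (b4 x).trans ?_⟩
  · positivity
  · rw [Real.sqrt_lt' one_pos]
    simp [hr₀', hr₁']
  · gcongr
    simp
  · gcongr
    simp
  · rw [Real.mul_self_sqrt hmax.le]
    exact mul_le_mul_of_nonneg_right (le_max_left _ _) ((norm_nonneg _).trans (a2 x))
  · rw [Real.mul_self_sqrt hmax.le]
    exact mul_le_mul_of_nonneg_right (le_max_right _ _) ((norm_nonneg _).trans (b2 x))

namespace AdaptedNorms

variable {n m : ℕ} {A : Matrix (Fin n) (Fin n) ℝ} {B : Matrix (Fin n) (Fin m) ℝ}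
  {K₀ K₁ : Matrix (Fin m) (Fin n) ℝ} {lam C : ℝ} {p₀ p₁ : EuclideanSpace ℝ (Fin n) → ℝ}

theorem nonneg₀ {F₀ F₁ : Matrix (Fin n) (Fin n) ℝ} (h : AdaptedNorms F₀ F₁ lam C p₀ p₁)
    (x : EuclideanSpace ℝ (Fin n)) : 0 ≤ p₀ x := (norm_nonneg x).trans (h.norm_le₀ x)

theorem nonneg₁ {F₀ F₁ : Matrix (Fin n) (Fin n) ℝ} (h : AdaptedNorms F₀ F₁ lam C p₀ p₁)
    (x : EuclideanSpace ℝ (Fin n)) : 0 ≤ p₁ x := (norm_nonneg x).trans (h.norm_le₁ x)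

theorem contract {F₀ F₁ : Matrix (Fin n) (Fin n) ℝ} (h : AdaptedNorms F₀ F₁ lam C p₀ p₁)
    (x : EuclideanSpace ℝ (Fin n)) : p₁ (mulVecE F₁ x) ≤ lam * p₁ x := by
  refine (h.contract₁ x).trans ?_
  rw [mul_assoc]
  have := mul_nonneg h.pos.le (h.nonneg₁ x)
  exact mul_le_of_le_one_left this h.lt_one.le

theorem norm_linearLoop_le (h : AdaptedNorms (A + B * K₀) (A + B * K₁) lam C p₀ p₁)
    (w : ℕ → EuclideanSpace ℝ (Fin n)) (k : ℕ) :
    ‖linearLoop A B K₁ w k‖ ≤ C * geomFilter lam (fun i => ‖w i‖) k := by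
  refine (h.norm_le₁ _).trans ?_
  refine le_mul_geomFilter (s := fun k => p₁ (linearLoop A B K₁ w k)) h.pos.le ?_ ?_ k
  · simpa [linearLoop] using h.le_norm₁ 0
  · intro k
    simp only [linearLoop]
    rw [← mulVecE_closedLoop]
    exact (h.add₁ _ _).trans (add_le_add (h.contract _) (h.le_norm₁ _))

/-- A Lyapunov function for the switched loop in the state `x` and the counter `ξ`. -/
def lyapunov (_ : AdaptedNorms (A + B * K₀) (A + B * K₁) lam C p₀ p₁) (N : ℕ)
    (x : EuclideanSpace ℝ (Fin n)) (ξ : ℕ) : ℝ :=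
  if ξ = 0 then p₁ x else C * lam ^ min ξ N * p₀ x

theorem lyapunov_add_le (h : AdaptedNorms (A + B * K₀) (A + B * K₁) lam C p₀ p₁) (N : ℕ)
    (x y : EuclideanSpace ℝ (Fin n)) (ξ : ℕ) :
    h.lyapunov N (x + y) ξ ≤ h.lyapunov N x ξ + C ^ 2 * ‖y‖ := by
  have hC := h.one_le
  have hl := h.pos
  unfold lyapunov
  split_ifs with h0
  · refine (h.add₁ x y).trans ?_
    have := h.le_norm₁ y
    have : C * ‖y‖ ≤ C ^ 2 * ‖y‖ := by
      gcongr
      nlinarith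
    linarith
  · calc C * lam ^ min ξ N * p₀ (x + y) ≤ C * lam ^ min ξ N * (p₀ x + p₀ y) := by
          gcongr
          exact h.add₀ x y
      _ = C * lam ^ min ξ N * p₀ x + C * lam ^ min ξ N * p₀ y := by ring
      _ ≤ C * lam ^ min ξ N * p₀ x + C * 1 * (C * ‖y‖) := by
          gcongr
          · exact h.nonneg₀ y
          · exact pow_le_one₀ hl.le h.lt_one.le
          · exact h.le_norm₀ y
      _ = _ := by ring

theorem norm_le_lyapunov (h : AdaptedNorms (A + B * K₀) (A + B * K₁) lam C p₀ p₁) (N : ℕ)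
    (x : EuclideanSpace ℝ (Fin n)) (ξ : ℕ) : lam ^ N * ‖x‖ ≤ h.lyapunov N x ξ := by
  have hC := h.one_le
  have hl := h.pos
  unfold lyapunov
  split_ifs with h0
  · exact (mul_le_of_le_one_left (norm_nonneg x) (pow_le_one₀ hl.le h.lt_one.le)).trans
      (h.norm_le₁ x)
  · have h1 : lam ^ N ≤ C * lam ^ min ξ N :=
      (pow_le_pow_of_le_one hl.le h.lt_one.le (min_le_right _ _)).trans
        (le_mul_of_one_le_left (by positivity) hC)
    exact mul_le_mul h1 (h.norm_le₀ x) (norm_nonneg x) (by positivity)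

/-- At a trigger the new weight `C * lam ^ N` absorbs the passage from `p₁` to `p₀`, because `C ^ 2
* lam ^ N ≤ 1`. During the dwell the weight grows by at most `lam⁻¹` per step while `p₀` shrinks by
`lam ^ 2`. When the counter reaches zero, the factor `C` carried in the weight pays for the return
to `p₁`. Capping the exponent at `N` keeps the comparison with the Euclidean norm independent of
`t`. -/
theorem lyapunov_step_le (h : AdaptedNorms (A + B * K₀) (A + B * K₁) lam C p₀ p₁) {N : ℕ}
    (hN : 1 ≤ N) (hCN : C ^ 2 * lam ^ N ≤ 1) {M : ℝ} {t : ℕ} (ht : N + 1 ≤ t)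
    (x : EuclideanSpace ℝ (Fin n)) (ξ : ℕ) :
    h.lyapunov N (mulVecE A x + mulVecE B (switchedControl K₀ K₁ M t x ξ).1)
      (switchedControl K₀ K₁ M t x ξ).2 ≤ lam * h.lyapunov N x ξ := by
  have hC := h.one_le
  have hl := h.pos
  have hp₀ := h.nonneg₀ x
  have hp₁ := h.nonneg₁ x
  unfold switchedControl
  split_ifs with h1 h2
  · simp only [← mulVecE_closedLoop]
    unfold lyapunov
    rw [if_neg h1.ne']
    split_ifs with h3
    · have : min ξ N = 1 := by omega
      rw [this]
      calc p₁ (mulVecE (A + B * K₀) x) ≤ C * ‖mulVecE (A + B * K₀) x‖ := h.le_norm₁ _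
        _ ≤ C * (lam * lam * p₀ x) := by
          gcongr
          exact (h.norm_le₀ _).trans (h.contract₀ x)
        _ = _ := by ring
    · have h4 : min ξ N ≤ min (ξ - 1) N + 1 := by omega
      calc C * lam ^ min (ξ - 1) N * p₀ (mulVecE (A + B * K₀) x)
          ≤ C * lam ^ min (ξ - 1) N * (lam * lam * p₀ x) := by
            gcongr
            exact h.contract₀ x
        _ = lam * (C * lam ^ (min (ξ - 1) N + 1) * p₀ x) := by ring
        _ ≤ _ := by
            have := pow_le_pow_of_le_one hl.le h.lt_one.le h4
            gcongr
  · simp only [← mulVecE_closedLoop]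
    have h0 : ξ = 0 := by omega
    unfold lyapunov
    rw [if_pos h0, if_neg (by omega), show min (t - 1) N = N by omega]
    calc C * lam ^ N * p₀ (mulVecE (A + B * K₀) x)
        ≤ C * lam ^ N * (lam * lam * (C * p₁ x)) := by
          gcongr
          refine (h.contract₀ x).trans ?_
          gcongr
          refine (h.le_norm₀ x).trans ?_
          gcongr
          exact h.norm_le₁ x
      _ = C ^ 2 * lam ^ N * (lam * (lam * p₁ x)) := by ring
      _ ≤ 1 * (1 * (lam * p₁ x)) := by
          gcongr
          exact h.lt_one.le
      _ = _ := by ring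
  · simp only [← mulVecE_closedLoop]
    have h0 : ξ = 0 := by omega
    unfold lyapunov
    rw [if_pos h0, if_pos rfl]
    exact h.contract x

/-- For long dwell times, the switched loop is dominated by a stable scalar filter,
uniformly in the threshold and the dwell time. -/
theorem exists_norm_switchedLoop_le (h : AdaptedNorms (A + B * K₀) (A + B * K₁) lam C p₀ p₁) :
    ∃ t₀ : ℕ, 1 ≤ t₀ ∧ ∃ L : ℝ, 1 ≤ L ∧ ∀ t, t₀ ≤ t → ∀ M w k,
      ‖(switchedLoop A B K₀ K₁ M t w k).1‖ ≤ L * geomFilter lam (fun i => ‖w i‖) k := by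
  have hC := h.one_le
  have hl := h.pos
  -- The decay `lam ^ N` has to absorb one factor `C` for each of the two changes of norm. A trigger
  -- leaves the counter at `t - 1`, hence the minimal dwell time `N + 1`.
  obtain ⟨N, hCN, hN⟩ : ∃ N : ℕ, C ^ 2 * lam ^ N ≤ 1 ∧ 1 ≤ N := by
    have h1 := (tendsto_pow_atTop_nhds_zero_of_lt_one hl.le h.lt_one).const_mul (C ^ 2)
    rw [mul_zero] at h1
    exact ((h1.eventually_le_const one_pos).and (eventually_ge_atTop 1)).exists
  refine ⟨N + 1, by omega, (lam ^ N)⁻¹ * C ^ 2, ?_, fun t ht M w k => ?_⟩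
  · exact one_le_mul_of_one_le_of_one_le
      ((one_le_inv₀ (by positivity)).2 (pow_le_one₀ hl.le h.lt_one.le)) (one_le_pow₀ hC)
  · rw [mul_assoc, le_inv_mul_iff₀ (by positivity)]
    refine (h.norm_le_lyapunov N _ (switchedLoop A B K₀ K₁ M t w k).2).trans ?_
    refine le_mul_geomFilter (s := fun k => h.lyapunov N (switchedLoop A B K₀ K₁ M t w k).1
      (switchedLoop A B K₀ K₁ M t w k).2) hl.le ?_ ?_ k
    · simpa [lyapunov, switchedLoop] using h.le_norm₁ 0
    · intro k
      simp only [switchedLoop_succ]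
      exact (h.lyapunov_add_le N _ _ _).trans
        (add_le_add (h.lyapunov_step_le hN hCN ht _ _) le_rfl)

end AdaptedNorms

/-! ### Pathwise bounds for the deviation of the stage cost -/

/-- The stage cost `xᵀ Q x + uᵀ R u`. -/
def stageCost {n m : ℕ} (Q : Matrix (Fin n) (Fin n) ℝ) (R : Matrix (Fin m) (Fin m) ℝ)
    (x : EuclideanSpace ℝ (Fin n)) (u : EuclideanSpace ℝ (Fin m)) : ℝ :=
  quadForm Q x + quadForm R u

/-- A bound for `d_k ^ 2` on the event that `d_j ≥ M` for some `j` among the last `t` times, with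
free parameter `ε`. -/
noncomputable def excursionBound (ε M : ℝ) (t : ℕ) (d : ℕ → ℝ) (k : ℕ) : ℝ :=
  ε ^ 2 * d k ^ 4 + (ε ^ 2)⁻¹ * (M ^ 4)⁻¹ * ∑ j ∈ Finset.Ico (k + 1 - t) (k + 1), d j ^ 4

theorem excursionBound_nonneg (ε M : ℝ) (t : ℕ) (d : ℕ → ℝ) (k : ℕ) :
    0 ≤ excursionBound ε M t d k := by
  unfold excursionBound
  have : 0 ≤ ∑ j ∈ Finset.Ico (k + 1 - t) (k + 1), d j ^ 4 :=
    Finset.sum_nonneg fun j _ => by positivity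
  positivity

/-- By Young's inequality d_k² ≤ ε² d_k⁴ + ε⁻². The trigger at j gives 1 ≤ (a d_j / M)⁴, a pathwise
form of Markov's inequality, and this factor multiplies the constant ε⁻². -/
theorem sq_le_excursionBound {ε M a : ℝ} (hε : 0 < ε) (hM : 0 < M) (t : ℕ) (d : ℕ → ℝ)
    (k : ℕ) (h : ∃ j ∈ Finset.Ico (k + 1 - t) (k + 1), M ≤ a * d j) :
    d k ^ 2 ≤ (1 + a ^ 4) * excursionBound ε M t d k := by
  obtain ⟨j, hj, hM'⟩ := h
  have h1 : M ^ 4 ≤ a ^ 4 * d j ^ 4 := by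
    rw [← mul_pow]
    exact pow_le_pow_left₀ hM.le hM' 4
  have h2 : d j ^ 4 ≤ ∑ j ∈ Finset.Ico (k + 1 - t) (k + 1), d j ^ 4 :=
    Finset.single_le_sum (f := fun j => d j ^ 4) (fun j _ => by positivity) hj
  have h3 : 1 ≤ a ^ 4 * ((M ^ 4)⁻¹ * ∑ j ∈ Finset.Ico (k + 1 - t) (k + 1), d j ^ 4) := by
    rw [mul_left_comm, le_inv_mul_iff₀ (by positivity), mul_one]
    exact h1.trans (by gcongr)
  set S := (M ^ 4)⁻¹ * ∑ j ∈ Finset.Ico (k + 1 - t) (k + 1), d j ^ 4 with hS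
  have hS0 : 0 ≤ S := by
    have : 0 ≤ ∑ j ∈ Finset.Ico (k + 1 - t) (k + 1), d j ^ 4 :=
      Finset.sum_nonneg fun j _ => by positivity
    positivity
  have h4 : d k ^ 2 ≤ ε ^ 2 * d k ^ 4 + (ε ^ 2)⁻¹ := by
    have h5 : (ε * d k ^ 2) * ε⁻¹ = d k ^ 2 := by field_simp
    have h6 := two_mul_le_add_sq (ε * d k ^ 2) ε⁻¹
    rw [mul_assoc, h5] at h6
    have : 0 ≤ d k ^ 2 := sq_nonneg _
    calc d k ^ 2 ≤ 2 * d k ^ 2 := by linarith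
      _ ≤ _ := h6
      _ = _ := by ring
  have h7 : excursionBound ε M t d k = ε ^ 2 * d k ^ 4 + (ε ^ 2)⁻¹ * S := by
    rw [excursionBound, hS, mul_assoc]
  rw [h7]
  have h8 : (ε ^ 2)⁻¹ * 1 ≤ (ε ^ 2)⁻¹ * (a ^ 4 * S) := by gcongr
  have h9 : 0 ≤ a ^ 4 * (ε ^ 2 * d k ^ 4) + (ε ^ 2)⁻¹ * S := by positivity
  linarith

/-- Polarization produces the product δ b, which Young's inequality splits with weight ε: in the
application δ² has mean of order ε², which makes both terms of order ε. -/
theorem abs_stageCost_sub_le {n m : ℕ} (Q : Matrix (Fin n) (Fin n) ℝ)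
    (R : Matrix (Fin m) (Fin m) ℝ) (x x' : EuclideanSpace ℝ (Fin n))
    (u u' : EuclideanSpace ℝ (Fin m)) {a b δ ε : ℝ} (hε : 0 < ε)
    (hx : ‖x‖ ≤ a * b) (hx' : ‖x'‖ ≤ a * b) (hu : ‖u‖ ≤ a * b) (hu' : ‖u'‖ ≤ a * b)
    (hxx : ‖x - x'‖ ≤ a * δ) (huu : ‖u - u'‖ ≤ a * δ) :
    |stageCost Q R x u - stageCost Q R x' u'|
      ≤ (‖Q‖ + ‖R‖) * a ^ 2 * (ε⁻¹ * δ ^ 2 + ε * b ^ 2) := by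
  have key {p : ℕ} (S : Matrix (Fin p) (Fin p) ℝ) (y y' : EuclideanSpace ℝ (Fin p))
      (hy : ‖y‖ ≤ a * b) (hy' : ‖y'‖ ≤ a * b) (hyy : ‖y - y'‖ ≤ a * δ) :
      |quadForm S y - quadForm S y'| ≤ ‖S‖ * (a ^ 2 * (2 * (δ * b))) := by
    refine (abs_quadForm_sub_le S y y').trans ?_
    refine mul_le_mul_of_nonneg_left ?_ (norm_nonneg S)
    calc ‖y - y'‖ * (‖y‖ + ‖y'‖) ≤ (a * δ) * (a * b + a * b) :=
          mul_le_mul hyy (add_le_add hy hy') (by positivity) ((norm_nonneg _).trans hyy)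
      _ = _ := by ring
  have h1 : 2 * (δ * b) ≤ ε⁻¹ * δ ^ 2 + ε * b ^ 2 := by
    have : ε⁻¹ * δ ^ 2 + ε * b ^ 2 - 2 * (δ * b) = ε⁻¹ * (δ - ε * b) ^ 2 := by
      field_simp
      ring
    have h2 : 0 ≤ ε⁻¹ * (δ - ε * b) ^ 2 := by positivity
    linarith
  calc |stageCost Q R x u - stageCost Q R x' u'|
      = |(quadForm Q x - quadForm Q x') + (quadForm R u - quadForm R u')| := by
        unfold stageCost
        congr 1
        ring
    _ ≤ ‖Q‖ * (a ^ 2 * (2 * (δ * b))) + ‖R‖ * (a ^ 2 * (2 * (δ * b))) :=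
        (abs_add_le _ _).trans (add_le_add (key Q x x' hx hx' hxx) (key R u u' hu hu' huu))
    _ = (‖Q‖ + ‖R‖) * a ^ 2 * (2 * (δ * b)) := by ring
    _ ≤ _ := by gcongr

/-- Deviation of the stage cost between a state `x` whose input uses one of two gains and a
state `y` whose input uses the gain `K₁`. -/
theorem abs_stageCost_sub_le_of_gains {n m : ℕ} (Q : Matrix (Fin n) (Fin n) ℝ)
    (R : Matrix (Fin m) (Fin m) ℝ) (K₀ K₁ : Matrix (Fin m) (Fin n) ℝ)
    {x y : EuclideanSpace ℝ (Fin n)} {u : EuclideanSpace ℝ (Fin m)} {L d c₁ c₂ E G ε : ℝ}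
    (hL : 1 ≤ L) (hε : 0 < ε) (hd : 0 ≤ d) (hc₁ : 0 ≤ c₁) (hc₂ : 0 ≤ c₂) (hE : 0 ≤ E)
    (hG : 0 ≤ G) (hx : ‖x‖ ≤ L * d) (hy : ‖y‖ ≤ L * d)
    (hu : u = mulVecE K₀ x ∨ u = mulVecE K₁ x) (hv : ‖u - mulVecE K₁ x‖ ^ 2 ≤ c₁ * E)
    (hxy : ‖x - y‖ ^ 2 ≤ c₂ * G) :
    |stageCost Q R x u - stageCost Q R y (mulVecE K₁ y)| ≤
      (‖Q‖ + ‖R‖) * ((1 + ‖K₀‖ + ‖K₁‖) * L) ^ 2 * (2 * (c₁ + c₂) + 1) *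
        (ε⁻¹ * (G + E) + ε * d ^ 2) := by
  have hK0 := norm_nonneg K₀
  have hK1 := norm_nonneg K₁
  have hK : 1 ≤ 1 + ‖K₀‖ + ‖K₁‖ := by linarith
  have ha1 : 1 + ‖K₀‖ + ‖K₁‖ ≤ (1 + ‖K₀‖ + ‖K₁‖) * L := le_mul_of_one_le_right (by positivity) hL
  have hLa : L ≤ (1 + ‖K₀‖ + ‖K₁‖) * L := le_mul_of_one_le_left (by positivity) hK
  have hgain (K : Matrix (Fin m) (Fin n) ℝ) (z : EuclideanSpace ℝ (Fin n))
      (hKn : ‖K‖ ≤ 1 + ‖K₀‖ + ‖K₁‖) (hz : ‖z‖ ≤ L * d) :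
      ‖mulVecE K z‖ ≤ (1 + ‖K₀‖ + ‖K₁‖) * L * d := by
    refine (norm_mulVecE_le K z).trans ?_
    rw [mul_assoc]
    exact mul_le_mul hKn hz (norm_nonneg z) (by positivity)
  have hud : ‖u‖ ≤ (1 + ‖K₀‖ + ‖K₁‖) * L * d := by
    rcases hu with rfl | rfl
    · exact hgain K₀ x (by linarith) hx
    · exact hgain K₁ x (by linarith) hx
  have hyd := hgain K₁ y (by linarith) hy
  generalize (1 + ‖K₀‖ + ‖K₁‖) * L = a at *
  have ha0 : 0 ≤ a := by linarith
  have hxy0 := norm_nonneg (x - y)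
  have hv0 : 0 ≤ ‖u - mulVecE K₁ x‖ := norm_nonneg _
  have hxy' : ‖x - y‖ ≤ a * (‖x - y‖ + ‖u - mulVecE K₁ x‖) := by
    have : 1 * (‖x - y‖ + ‖u - mulVecE K₁ x‖) ≤ a * (‖x - y‖ + ‖u - mulVecE K₁ x‖) :=
      mul_le_mul_of_nonneg_right (by linarith) (by positivity)
    linarith
  -- The input deviates for two reasons: the states differ, and the gain in use may be `K₀`.
  have huy : ‖u - mulVecE K₁ y‖ ≤ a * (‖x - y‖ + ‖u - mulVecE K₁ x‖) := by
    have h1 : u - mulVecE K₁ y = mulVecE K₁ (x - y) + (u - mulVecE K₁ x) := by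
      rw [mulVecE_sub]
      abel
    rw [h1, mul_add]
    refine (norm_add_le _ _).trans (add_le_add ?_ (le_mul_of_one_le_left hv0 (by linarith)))
    exact (norm_mulVecE_le _ _).trans (mul_le_mul_of_nonneg_right (by linarith) hxy0)
  refine (abs_stageCost_sub_le Q R x y u (mulVecE K₁ y) hε (hx.trans (by gcongr))
    (hy.trans (by gcongr)) hud hyd hxy' huy).trans ?_
  rw [mul_assoc ((‖Q‖ + ‖R‖) * a ^ 2)]
  have hsq : (‖x - y‖ + ‖u - mulVecE K₁ x‖) ^ 2 ≤ 2 * (c₁ + c₂) * (G + E) := by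
    have h1 : (‖x - y‖ + ‖u - mulVecE K₁ x‖) ^ 2
      ≤ 2 * (‖x - y‖ ^ 2 + ‖u - mulVecE K₁ x‖ ^ 2) := add_sq_le
    have h2 : 0 ≤ c₁ * G + c₂ * E := by positivity
    linarith
  refine mul_le_mul_of_nonneg_left ?_ (by positivity)
  calc ε⁻¹ * (‖x - y‖ + ‖u - mulVecE K₁ x‖) ^ 2 + ε * d ^ 2
      ≤ ε⁻¹ * (2 * (c₁ + c₂) * (G + E)) + ε * d ^ 2 := by gcongr
    _ ≤ (2 * (c₁ + c₂) + 1) * (ε⁻¹ * (G + E) + ε * d ^ 2) := by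
      have h1 : 0 ≤ ε⁻¹ * (G + E) + 2 * (c₁ + c₂) * (ε * d ^ 2) := by positivity
      linarith

namespace AdaptedNorms

variable {n m : ℕ} {A : Matrix (Fin n) (Fin n) ℝ} {B : Matrix (Fin n) (Fin m) ℝ}
  {K₀ K₁ : Matrix (Fin m) (Fin n) ℝ} {lam C : ℝ} {p₀ p₁ : EuclideanSpace ℝ (Fin n) → ℝ}

/-- The deviation of the switched loop from the linear loop is driven by the deviation of the
inputs. -/
theorem sq_norm_switchedLoop_sub_linearLoop_le
    (h : AdaptedNorms (A + B * K₀) (A + B * K₁) lam C p₀ p₁) (M : ℝ) (t : ℕ)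
    (w : ℕ → EuclideanSpace ℝ (Fin n)) (k : ℕ) :
    ‖(switchedLoop A B K₀ K₁ M t w k).1 - linearLoop A B K₁ w k‖ ^ 2 ≤
      (1 - lam)⁻¹ * (C * ‖B‖) ^ 2 * geomFilter lam (fun k => ‖switchedInput A B K₀ K₁ M t w k
        - mulVecE K₁ (switchedLoop A B K₀ K₁ M t w k).1‖ ^ 2) k := by
  have hC := h.one_le
  have hl := h.pos
  refine (pow_le_pow_left₀ (norm_nonneg _) (h.norm_le₁ _) 2).trans ?_
  refine le_mul_geomFilter (s := fun k =>
    p₁ ((switchedLoop A B K₀ K₁ M t w k).1 - linearLoop A B K₁ w k) ^ 2) hl.le ?_ ?_ k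
  · have h1 := h.le_norm₁ 0
    have h2 := h.nonneg₁ 0
    rw [norm_zero, mul_zero] at h1
    simp [switchedLoop, linearLoop, le_antisymm h1 h2]
  · intro k
    simp only [linearLoop, switchedLoop_succ_fst]
    set x := (switchedLoop A B K₀ K₁ M t w k).1
    set y := linearLoop A B K₁ w k
    set u := switchedInput A B K₀ K₁ M t w k
    have h1 : mulVecE A x + mulVecE B u + w k - (mulVecE A y + mulVecE B (mulVecE K₁ y) + w k)
        = mulVecE (A + B * K₁) (x - y) + mulVecE B (u - mulVecE K₁ x) := by
      rw [mulVecE_sub, mulVecE_sub, mulVecE_closedLoop, mulVecE_closedLoop]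
      abel
    rw [h1]
    have h2 : p₁ (mulVecE (A + B * K₁) (x - y) + mulVecE B (u - mulVecE K₁ x))
        ≤ lam * p₁ (x - y) + C * ‖B‖ * ‖u - mulVecE K₁ x‖ := by
      refine (h.add₁ _ _).trans (add_le_add (h.contract _) ((h.le_norm₁ _).trans ?_))
      rw [mul_assoc]
      gcongr
      exact norm_mulVecE_le _ _
    refine (pow_le_pow_left₀ (h.nonneg₁ _) h2 2).trans ?_
    refine (sq_add_le hl h.lt_one _ _).trans (le_of_eq ?_)
    ring

/-- Outside fallback the difference vanishes. During fallback it equals (K₀ - K₁) x_k, bounded by a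
multiple of d_k, and a trigger lies within the last `t` steps. -/
theorem sq_norm_switchedInput_sub_le {L M ε : ℝ} {t : ℕ} {w : ℕ → EuclideanSpace ℝ (Fin n)}
    {d : ℕ → ℝ} (hM : 0 < M) (ht : 1 ≤ t) (hε : 0 < ε)
    (hd : ∀ k, ‖(switchedLoop A B K₀ K₁ M t w k).1‖ ≤ L * d k) (k : ℕ) :
    ‖switchedInput A B K₀ K₁ M t w k - mulVecE K₁ (switchedLoop A B K₀ K₁ M t w k).1‖ ^ 2
      ≤ (‖K₁ - K₀‖ * L) ^ 2 * (1 + (‖K₁ - K₀‖ * L) ^ 4) * excursionBound ε M t d k := by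
  have hb := excursionBound_nonneg ε M t d k
  have hKd (j : ℕ) : ‖mulVecE (K₁ - K₀) (switchedLoop A B K₀ K₁ M t w j).1‖
      ≤ ‖K₁ - K₀‖ * L * d j := by
    rw [mul_assoc]
    exact (norm_mulVecE_le _ _).trans (mul_le_mul_of_nonneg_left (hd j) (norm_nonneg _))
  by_cases hf : IsFallback A B K₀ K₁ M t w k
  · rw [switchedInput_of_isFallback hf, norm_sub_rev, ← sub_mulVecE]
    obtain ⟨j, hj, hjM⟩ := hf.exists_trigger ht
    refine (pow_le_pow_left₀ (norm_nonneg _) (hKd k) 2).trans ?_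
    rw [mul_pow, mul_assoc ((‖K₁ - K₀‖ * L) ^ 2)]
    exact mul_le_mul_of_nonneg_left
      (sq_le_excursionBound hε hM t d k ⟨j, hj, hjM.trans (hKd j)⟩) (by positivity)
  · rw [switchedInput_of_not_isFallback hf, sub_self, norm_zero, zero_pow two_ne_zero]
    exact mul_nonneg (by positivity) hb

/-- Fallback acts directly through the current input, which gives the plain `excursionBound`, and
through the state it has displaced, which gives the filtered one. The constant depends on none of
`M`, `t`, `ε`. -/
theorem exists_abs_stageCost_sub_le
    (h : AdaptedNorms (A + B * K₀) (A + B * K₁) lam C p₀ p₁)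
    (Q : Matrix (Fin n) (Fin n) ℝ) (R : Matrix (Fin m) (Fin m) ℝ) :
    ∃ t₀ : ℕ, ∃ c : ℝ, 0 ≤ c ∧ ∀ t, t₀ ≤ t → ∀ M, 0 < M → ∀ ε, 0 < ε → ∀ w k,
      |stageCost Q R (switchedLoop A B K₀ K₁ M t w k).1 (switchedInput A B K₀ K₁ M t w k)
        - stageCost Q R (linearLoop A B K₁ w k) (mulVecE K₁ (linearLoop A B K₁ w k))| ≤
      c * (ε⁻¹ * (geomFilter lam (excursionBound ε M t (geomFilter lam fun i => ‖w i‖)) k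
        + excursionBound ε M t (geomFilter lam fun i => ‖w i‖) k)
        + ε * geomFilter lam (fun i => ‖w i‖) k ^ 2) := by
  have hC := h.one_le
  have hl := h.pos
  have hl1 : 0 < 1 - lam := by linarith [h.lt_one]
  obtain ⟨t₀, ht₀, L, hL, hsw⟩ := h.exists_norm_switchedLoop_le
  obtain ⟨c₁, hc₁⟩ : ∃ c₁, c₁ = (‖K₁ - K₀‖ * L) ^ 2 * (1 + (‖K₁ - K₀‖ * L) ^ 4) := ⟨_, rfl⟩
  have hc₁0 : 0 ≤ c₁ := by rw [hc₁]; positivity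
  have hc₂0 : 0 ≤ (1 - lam)⁻¹ * (C * ‖B‖) ^ 2 * c₁ := by positivity
  -- `L + C` serves both loops: `L` bounds the switched state and `C` the linear one.
  refine ⟨t₀, (‖Q‖ + ‖R‖) * ((1 + ‖K₀‖ + ‖K₁‖) * (L + C)) ^ 2 *
    (2 * (c₁ + (1 - lam)⁻¹ * (C * ‖B‖) ^ 2 * c₁) + 1), by positivity,
    fun t ht M hM ε hε w k => ?_⟩
  have hd0 : ∀ k, 0 ≤ geomFilter lam (fun i => ‖w i‖) k :=
    geomFilter_nonneg hl.le fun i => norm_nonneg _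
  have hv := sq_norm_switchedInput_sub_le hM (ht₀.trans ht) hε (hsw t ht M w)
  rw [← hc₁] at hv
  refine abs_stageCost_sub_le_of_gains Q R K₀ K₁ (by linarith) hε (hd0 k) hc₁0 hc₂0
    (excursionBound_nonneg _ _ _ _ k)
    (geomFilter_nonneg hl.le (excursionBound_nonneg _ _ _ _) k)
    ((hsw t ht M w k).trans (mul_le_mul_of_nonneg_right (by linarith) (hd0 k)))
    ((h.norm_linearLoop_le w k).trans (mul_le_mul_of_nonneg_right (by linarith) (hd0 k)))
    ?_ (hv k) ?_
  · by_cases hf : IsFallback A B K₀ K₁ M t w k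
    · exact Or.inl (switchedInput_of_isFallback hf)
    · exact Or.inr (switchedInput_of_not_isFallback hf)
  · rw [mul_assoc _ c₁]
    refine (h.sq_norm_switchedLoop_sub_linearLoop_le M t w k).trans
      (mul_le_mul_of_nonneg_left ?_ (by positivity))
    exact le_mul_geomFilter hl.le le_rfl (fun k => add_le_add_right (hv k) _) k

theorem exists_stageCost_linearLoop_le
    (h : AdaptedNorms (A + B * K₀) (A + B * K₁) lam C p₀ p₁)
    (Q : Matrix (Fin n) (Fin n) ℝ) (R : Matrix (Fin m) (Fin m) ℝ) :
    ∃ c : ℝ, 0 ≤ c ∧ ∀ w k,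
      stageCost Q R (linearLoop A B K₁ w k) (mulVecE K₁ (linearLoop A B K₁ w k))
        ≤ c * geomFilter lam (fun i => ‖w i‖) k ^ 2 := by
  refine ⟨‖Q‖ * C ^ 2 + ‖R‖ * (‖K₁‖ * C) ^ 2, by positivity, fun w k => ?_⟩
  have key {p : ℕ} (S : Matrix (Fin p) (Fin p) ℝ) (y : EuclideanSpace ℝ (Fin p)) {b : ℝ}
      (hy : ‖y‖ ≤ b) : quadForm S y ≤ ‖S‖ * b ^ 2 := by
    have h1 := abs_quadForm_sub_le S y 0
    rw [quadForm_zero, sub_zero, sub_zero, norm_zero, add_zero, ← sq] at h1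
    exact (le_abs_self _).trans (h1.trans (by gcongr))
  have hy := h.norm_linearLoop_le w k
  have hu : ‖mulVecE K₁ (linearLoop A B K₁ w k)‖
      ≤ ‖K₁‖ * (C * geomFilter lam (fun i => ‖w i‖) k) :=
    (norm_mulVecE_le _ _).trans (by gcongr)
  refine (add_le_add (key Q _ hy) (key R _ hu)).trans (le_of_eq ?_)
  ring

end AdaptedNorms

end

/-! ### Expectations and long-run averages -/

section Expectation

variable {Ω : Type*} [MeasurableSpace Ω] {μ : Measure Ω}

/-- `f` is integrable with integral at most `c`. -/
def HasMeanLE (μ : Measure Ω) (f : Ω → ℝ) (c : ℝ) : Prop :=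
  Integrable f μ ∧ ∫ ω, f ω ∂μ ≤ c

namespace HasMeanLE

theorem add {f g : Ω → ℝ} {a b : ℝ} (hf : HasMeanLE μ f a) (hg : HasMeanLE μ g b) :
    HasMeanLE μ (fun ω => f ω + g ω) (a + b) := by
  refine ⟨hf.1.add hg.1, ?_⟩
  rw [integral_add hf.1 hg.1]
  exact add_le_add hf.2 hg.2

theorem const_mul {f : Ω → ℝ} {a r : ℝ} (hf : HasMeanLE μ f a) (hr : 0 ≤ r) :
    HasMeanLE μ (fun ω => r * f ω) (r * a) := by
  refine ⟨hf.1.const_mul r, ?_⟩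
  rw [integral_const_mul]
  exact mul_le_mul_of_nonneg_left hf.2 hr

theorem weaken {f : Ω → ℝ} {a b : ℝ} (hf : HasMeanLE μ f a) (hab : a ≤ b) :
    HasMeanLE μ f b := ⟨hf.1, hf.2.trans hab⟩

theorem of_le {f g : Ω → ℝ} {a : ℝ} (hg : HasMeanLE μ g a) (hf : AEStronglyMeasurable f μ)
    (h0 : ∀ ω, 0 ≤ f ω) (hfg : ∀ ω, f ω ≤ g ω) : HasMeanLE μ f a := by
  have hi : Integrable f μ := hg.1.mono' hf <| .of_forall fun ω => by
    rw [Real.norm_of_nonneg (h0 ω)]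
    exact hfg ω
  exact ⟨hi, (integral_mono hi hg.1 hfg).trans hg.2⟩

theorem sum {ι : Type*} {f : ι → Ω → ℝ} {a : ℝ} (s : Finset ι)
    (hf : ∀ i ∈ s, HasMeanLE μ (f i) a) :
    HasMeanLE μ (fun ω => ∑ i ∈ s, f i ω) (s.card * a) := by
  refine ⟨integrable_finsetSum _ fun i hi => (hf i hi).1, ?_⟩
  rw [integral_finsetSum _ fun i hi => (hf i hi).1, ← nsmul_eq_mul]
  exact Finset.sum_le_card_nsmul _ _ _ fun i hi => (hf i hi).2

/-- The bound is the fixed point of s ↦ c s + a, and the filter starts below it. -/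
theorem geomFilter {f : ℕ → Ω → ℝ} {a c : ℝ} (hc0 : 0 ≤ c) (hc : c < 1) (ha : 0 ≤ a)
    (hf : ∀ k, HasMeanLE μ (f k) a) (k : ℕ) :
    HasMeanLE μ (fun ω => geomFilter c (fun i => f i ω) k) ((1 - c)⁻¹ * a) := by
  have h1 : 0 < 1 - c := by linarith
  induction k with
  | zero =>
    refine ⟨integrable_zero _ _ _, ?_⟩
    simp only [_root_.geomFilter, integral_zero]
    positivity
  | succ k ih =>
    refine ((ih.const_mul hc0).add (hf k)).weaken (le_of_eq ?_)
    field_simp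
    ring

/-- The origin of the rate: the window contributes at most ε⁻² M⁻⁴ t a, and t = ε⁴ M⁴ balances this
against the other term ε² a. -/
theorem excursionBound {d : ℕ → Ω → ℝ} {a : ℝ} (ha : 0 ≤ a)
    (hd : ∀ k, HasMeanLE μ (fun ω => d k ω ^ 4) a) {ε M : ℝ} {t : ℕ} (hε : 0 < ε) (hM : 0 < M)
    (ht : (t : ℝ) = ε ^ 4 * M ^ 4) (k : ℕ) :
    HasMeanLE μ (fun ω => excursionBound ε M t (fun i => d i ω) k) (ε ^ 2 * (2 * a)) := by
  refine (((hd k).const_mul (sq_nonneg ε)).add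
    ((HasMeanLE.sum (Finset.Ico (k + 1 - t) (k + 1)) fun j _ => hd j).const_mul
      (r := (ε ^ 2)⁻¹ * (M ^ 4)⁻¹) (by positivity))).weaken ?_
  -- Only an inequality: for k + 1 < t the truncated subtraction cuts the window off at time 0.
  have h1 : ((Finset.Ico (k + 1 - t) (k + 1)).card : ℝ) ≤ t := by
    rw [Nat.card_Ico]
    exact_mod_cast (by omega : k + 1 - (k + 1 - t) ≤ t)
  calc ε ^ 2 * a + (ε ^ 2)⁻¹ * (M ^ 4)⁻¹ * ((Finset.Ico (k + 1 - t) (k + 1)).card * a)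
      ≤ ε ^ 2 * a + (ε ^ 2)⁻¹ * (M ^ 4)⁻¹ * (ε ^ 4 * M ^ 4 * a) := by
        rw [← ht]
        gcongr
    _ = ε ^ 2 * (2 * a) := by
        field_simp
        ring

end HasMeanLE

theorem measurable_geomFilter {c : ℝ} {f : ℕ → Ω → ℝ} (hf : ∀ k, Measurable (f k)) (k : ℕ) :
    Measurable fun ω => geomFilter c (fun i => f i ω) k := by
  induction k with
  | zero => exact measurable_const
  | succ k ih => exact (ih.const_mul c).add (hf k)

/-- By `pow_four_add_le` the fourth power of the filter response is dominated pathwise by the filter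
response to the fourth powers, whose mean is bounded. -/
theorem hasMeanLE_geomFilter_pow_four {c a : ℝ} (hc0 : 0 < c) (hc : c < 1) (ha : 0 ≤ a)
    {f : ℕ → Ω → ℝ} (hfm : ∀ k, Measurable (f k))
    (hf : ∀ k, HasMeanLE μ (fun ω => f k ω ^ 4) a) (k : ℕ) :
    HasMeanLE μ (fun ω => geomFilter c (fun i => f i ω) k ^ 4)
      (((1 - c)⁻¹) ^ 3 * ((1 - c)⁻¹ * a)) := by
  have h1 : 0 < 1 - c := by linarith
  refine ((HasMeanLE.geomFilter hc0.le hc ha hf k).const_mul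
    (r := ((1 - c)⁻¹) ^ 3) (by positivity)).of_le
    ((measurable_geomFilter hfm k).pow_const 4).aestronglyMeasurable
    (fun ω => by positivity) fun ω => ?_
  exact le_mul_geomFilter (s := fun k => geomFilter c (fun i => f i ω) k ^ 4) hc0.le
    (by simp [geomFilter]) (fun k => pow_four_add_le hc0 hc _ _) k

theorem HasMeanLE.sq [IsProbabilityMeasure μ] {f : Ω → ℝ} {a : ℝ} (hfm : Measurable f)
    (hf : HasMeanLE μ (fun ω => f ω ^ 4) a) : HasMeanLE μ (fun ω => f ω ^ 2) (1 + a) := by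
  have h1 : HasMeanLE μ (fun _ : Ω => (1 : ℝ)) 1 := ⟨integrable_const 1, by simp⟩
  refine (h1.add hf).of_le (hfm.pow_const 2).aestronglyMeasurable (fun ω => by positivity)
    fun ω => ?_
  nlinarith [sq_nonneg (f ω ^ 2 - 1), sq_nonneg (f ω)]

/-- The long-run average of the expectations of nonnegative stage costs. -/
noncomputable def averageCost (μ : Measure Ω) (g : ℕ → Ω → ℝ) : ℝ≥0∞ :=
  limsup (fun T : ℕ => (T : ℝ≥0∞)⁻¹ *
    ∫⁻ ω, ENNReal.ofReal (∑ k ∈ Finset.range T, g k ω) ∂μ) atTop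

/-- The integrals are compared at each horizon T, before the limsup. Additivity of the lower
integral needs measurability of one summand only, so measurability of f suffices and none is asked
of the stage costs g and g'. -/
theorem averageCost_le_add {g g' f : ℕ → Ω → ℝ} {a : ℝ}
    (h : ∀ k ω, g k ω ≤ g' k ω + f k ω) (hf0 : ∀ k ω, 0 ≤ f k ω)
    (hf : ∀ k, HasMeanLE μ (f k) a) :
    averageCost μ g ≤ averageCost μ g' + ENNReal.ofReal a := by
  unfold averageCost
  rw [← limsup_add_const atTop _ _ (by isBoundedDefault) (by isBoundedDefault)]
  refine limsup_le_limsup ?_ (by isBoundedDefault) (by isBoundedDefault)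
  filter_upwards [eventually_ge_atTop 1] with T hT
  have hs := HasMeanLE.sum (Finset.range T) fun k _ => hf k
  have hs0 : ∀ ω, 0 ≤ ∑ k ∈ Finset.range T, f k ω := fun ω =>
    Finset.sum_nonneg fun k _ => hf0 k ω
  have hT0 : (T : ℝ≥0∞) ≠ 0 := by
    simpa using (by omega : T ≠ 0)
  have h1 : ∫⁻ ω, ENNReal.ofReal (∑ k ∈ Finset.range T, f k ω) ∂μ ≤ T * ENNReal.ofReal a := by
    rw [← ofReal_integral_eq_lintegral_ofReal hs.1 (.of_forall hs0)]
    refine (ENNReal.ofReal_le_ofReal hs.2).trans (le_of_eq ?_)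
    rw [Finset.card_range, ENNReal.ofReal_mul (Nat.cast_nonneg T), ENNReal.ofReal_natCast]
  calc (T : ℝ≥0∞)⁻¹ * ∫⁻ ω, ENNReal.ofReal (∑ k ∈ Finset.range T, g k ω) ∂μ
      ≤ (T : ℝ≥0∞)⁻¹ * ∫⁻ ω, (ENNReal.ofReal (∑ k ∈ Finset.range T, g' k ω)
          + ENNReal.ofReal (∑ k ∈ Finset.range T, f k ω)) ∂μ := by
        gcongr with ω
        refine (ENNReal.ofReal_le_ofReal ?_).trans ENNReal.ofReal_add_le
        rw [← Finset.sum_add_distrib]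
        exact Finset.sum_le_sum fun k _ => h k ω
    _ = (T : ℝ≥0∞)⁻¹ * ∫⁻ ω, ENNReal.ofReal (∑ k ∈ Finset.range T, g' k ω) ∂μ
          + (T : ℝ≥0∞)⁻¹ * ∫⁻ ω, ENNReal.ofReal (∑ k ∈ Finset.range T, f k ω) ∂μ := by
        rw [lintegral_add_right' _ hs.1.aemeasurable.ennreal_ofReal, mul_add]
    _ ≤ _ := by
        gcongr
        calc _ ≤ (T : ℝ≥0∞)⁻¹ * (T * ENNReal.ofReal a) := by gcongr
          _ = ENNReal.ofReal a := by
            rw [← mul_assoc, ENNReal.inv_mul_cancel hT0 (ENNReal.natCast_ne_top T), one_mul]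

theorem averageCost_zero : averageCost μ (fun _ _ => (0 : ℝ)) = 0 := by
  simp [averageCost]

end Expectation

/-! ### Comparison of the two costs -/

theorem linearCost_eq_averageCost {n m : ℕ} {Ω : Type*} [MeasurableSpace Ω] (μ : Measure Ω)
    (A : Matrix (Fin n) (Fin n) ℝ) (B : Matrix (Fin n) (Fin m) ℝ)
    (Q : Matrix (Fin n) (Fin n) ℝ) (R : Matrix (Fin m) (Fin m) ℝ)
    (K : Matrix (Fin m) (Fin n) ℝ) (w : ℕ → Ω → EuclideanSpace ℝ (Fin n)) :
    linearCost μ A B Q R K w = averageCost μ fun k ω =>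
      stageCost Q R (linearLoop A B K (fun i => w i ω) k)
        (mulVecE K (linearLoop A B K (fun i => w i ω) k)) := rfl

theorem switchedCost_eq_averageCost {n m : ℕ} {Ω : Type*} [MeasurableSpace Ω] (μ : Measure Ω)
    (A : Matrix (Fin n) (Fin n) ℝ) (B : Matrix (Fin n) (Fin m) ℝ)
    (Q : Matrix (Fin n) (Fin n) ℝ) (R : Matrix (Fin m) (Fin m) ℝ)
    (K₀ K₁ : Matrix (Fin m) (Fin n) ℝ) (w : ℕ → Ω → EuclideanSpace ℝ (Fin n))
    (M : ℝ) (t : ℕ) :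
    switchedCost μ A B Q R K₀ K₁ w M t = averageCost μ fun k ω =>
      stageCost Q R (switchedLoop A B K₀ K₁ M t (fun i => w i ω) k).1
        (switchedInput A B K₀ K₁ M t (fun i => w i ω) k) := rfl

theorem IsNoise.hasMeanLE {n : ℕ} {Ω : Type*} [MeasurableSpace Ω] {μ : Measure Ω}
    {w : ℕ → Ω → EuclideanSpace ℝ (Fin n)} {W : Matrix (Fin n) (Fin n) ℝ} {μ₄ : ℝ}
    (hw : IsNoise μ w W μ₄) (k : ℕ) : HasMeanLE μ (fun ω => ‖w k ω‖ ^ 4) μ₄ := by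
  refine ⟨?_, (hw.fourthMoment k).le⟩
  exact_mod_cast (hw.memLp k).integrable_norm_pow (p := 4) (by norm_num)

/-- For long dwell times, the costs of the switched and of the linear loop differ by
`O(t ^ (1 / 4) / M)`, uniformly in the threshold. -/
theorem exists_switchedCost_linearCost_close {n m : ℕ} {Ω : Type*} [MeasurableSpace Ω]
    (μ : Measure Ω) [IsProbabilityMeasure μ]
    (A : Matrix (Fin n) (Fin n) ℝ) (B : Matrix (Fin n) (Fin m) ℝ)
    (Q : Matrix (Fin n) (Fin n) ℝ) (R : Matrix (Fin m) (Fin m) ℝ)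
    (K₀ K₁ : Matrix (Fin m) (Fin n) ℝ)
    (hK₀ : IsSchurStable (A + B * K₀)) (hK₁ : IsSchurStable (A + B * K₁))
    (W : Matrix (Fin n) (Fin n) ℝ) (μ₄ : ℝ)
    (w : ℕ → Ω → EuclideanSpace ℝ (Fin n)) (hw : IsNoise μ w W μ₄) :
    linearCost μ A B Q R K₁ w ≠ ∞ ∧ ∃ t₀ : ℕ, ∃ c : ℝ, 0 ≤ c ∧
      ∀ t : ℕ, t₀ ≤ t → ∀ M ε : ℝ, 0 < M → 0 < ε → (t : ℝ) = ε ^ 4 * M ^ 4 →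
      switchedCost μ A B Q R K₀ K₁ w M t
          ≤ linearCost μ A B Q R K₁ w + ENNReal.ofReal (c * ε) ∧
        linearCost μ A B Q R K₁ w
          ≤ switchedCost μ A B Q R K₀ K₁ w M t + ENNReal.ofReal (c * ε) := by
  obtain ⟨lam, C, p₀, p₁, h⟩ := exists_adaptedNorms hK₀ hK₁
  have hl := h.pos
  have hl1 : 0 < 1 - lam := by linarith [h.lt_one]
  have hμ₄ : 0 ≤ μ₄ := by
    rw [← hw.fourthMoment 0]
    exact integral_nonneg fun ω => by positivity
  have hwm : ∀ k, Measurable fun ω => ‖w k ω‖ := fun k => (hw.measurable k).norm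
  have hd := hasMeanLE_geomFilter_pow_four hl h.lt_one hμ₄ hwm hw.hasMeanLE
  have hκ : 0 ≤ ((1 - lam)⁻¹) ^ 3 * ((1 - lam)⁻¹ * μ₄) := by positivity
  generalize ((1 - lam)⁻¹) ^ 3 * ((1 - lam)⁻¹ * μ₄) = κ at hd hκ
  have hd2 := fun k => (hd k).sq (measurable_geomFilter hwm k)
  refine ⟨?_, ?_⟩
  · obtain ⟨c, hc, hle⟩ := h.exists_stageCost_linearLoop_le Q R
    -- Finiteness of the linear cost comes from comparison with the zero cost.
    have := averageCost_le_add (μ := μ) (g' := fun _ _ => 0)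
      (g := fun k ω => stageCost Q R (linearLoop A B K₁ (fun i => w i ω) k)
        (mulVecE K₁ (linearLoop A B K₁ (fun i => w i ω) k)))
      (fun k ω => (hle (fun i => w i ω) k).trans_eq (zero_add _).symm)
      (fun k ω => by positivity) (fun k => (hd2 k).const_mul hc)
    rw [averageCost_zero, zero_add] at this
    rw [linearCost_eq_averageCost]
    exact ne_top_of_le_ne_top ENNReal.ofReal_ne_top this
  · obtain ⟨t₀, c, hc, hle⟩ := h.exists_abs_stageCost_sub_le Q R
    -- The filtered and the plain excursion bound have means at most (1 - lam)⁻¹ · 2κε² and 2κε²,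
    -- and are multiplied by ε⁻¹; the squared size has mean at most 1 + κ and is multiplied by ε.
    refine ⟨t₀, c * (((1 - lam)⁻¹ + 1) * (2 * κ) + (1 + κ)), by positivity,
      fun t ht M ε hM hε htM => ?_⟩
    have hb := HasMeanLE.excursionBound hκ hd hε hM htM
    have hgb := HasMeanLE.geomFilter hl.le h.lt_one (by positivity) hb
    have hf : ∀ k, HasMeanLE μ (fun ω => c * (ε⁻¹ *
        (geomFilter lam (excursionBound ε M t (geomFilter lam fun i => ‖w i ω‖)) k
          + excursionBound ε M t (geomFilter lam fun i => ‖w i ω‖) k)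
        + ε * geomFilter lam (fun i => ‖w i ω‖) k ^ 2))
        (c * (((1 - lam)⁻¹ + 1) * (2 * κ) + (1 + κ)) * ε) := by
      intro k
      refine (((((hgb k).add (hb k)).const_mul (inv_nonneg.2 hε.le)).add
        ((hd2 k).const_mul hε.le)).const_mul hc).weaken (le_of_eq ?_)
      field_simp
    have hf0 : ∀ k ω, 0 ≤ c * (ε⁻¹ *
        (geomFilter lam (excursionBound ε M t (geomFilter lam fun i => ‖w i ω‖)) k
          + excursionBound ε M t (geomFilter lam fun i => ‖w i ω‖) k)
        + ε * geomFilter lam (fun i => ‖w i ω‖) k ^ 2) := by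
      intro k ω
      have h1 := excursionBound_nonneg ε M t (geomFilter lam fun i => ‖w i ω‖)
      have h2 := geomFilter_nonneg hl.le h1 k
      have h3 := h1 k
      positivity
    rw [switchedCost_eq_averageCost, linearCost_eq_averageCost]
    refine ⟨averageCost_le_add (fun k ω => ?_) hf0 hf, averageCost_le_add (fun k ω => ?_) hf0 hf⟩
    · have := (abs_le.1 (hle t ht M hM ε hε (fun i => w i ω) k)).2
      linarith
    · have := (abs_le.1 (hle t ht M hM ε hε (fun i => w i ω) k)).1
      linarith

theorem eventually_thresholdDwellRegime (t₀ : ℕ) :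
    ∀ᶠ p : ℝ × ℕ in thresholdDwellRegime, 0 < p.1 ∧ 1 ≤ p.2 ∧ t₀ ≤ p.2 := by
  have h : ∀ᶠ p : ℝ × ℕ in atTop ×ˢ atTop, 0 < p.1 ∧ 1 ≤ p.2 ∧ t₀ ≤ p.2 :=
    (eventually_gt_atTop (0 : ℝ)).prod_mk ((eventually_ge_atTop 1).and (eventually_ge_atTop t₀))
  exact h.filter_mono inf_le_left

theorem corollary2 {n m : ℕ} {Ω : Type*} [MeasurableSpace Ω] (μ : Measure Ω)
    [IsProbabilityMeasure μ]
    (A : Matrix (Fin n) (Fin n) ℝ) (B : Matrix (Fin n) (Fin m) ℝ)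
    (Q : Matrix (Fin n) (Fin n) ℝ) (R : Matrix (Fin m) (Fin m) ℝ)
    (hQ : Q.PosDef) (hR : R.PosDef)
    (K₀ K₁ : Matrix (Fin m) (Fin n) ℝ)
    (hK₀ : IsSchurStable (A + B * K₀)) (hK₁ : IsSchurStable (A + B * K₁))
    (W : Matrix (Fin n) (Fin n) ℝ) (hW : W.PosDef) (μ₄ : ℝ)
    (w : ℕ → Ω → EuclideanSpace ℝ (Fin n)) (hw : IsNoise μ w W μ₄) :
    linearCost μ A B Q R K₁ w ≠ ∞ ∧
    (∀ᶠ p : ℝ × ℕ in thresholdDwellRegime, switchedCost μ A B Q R K₀ K₁ w p.1 p.2 ≠ ∞) ∧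
    (fun p : ℝ × ℕ =>
        (switchedCost μ A B Q R K₀ K₁ w p.1 p.2).toReal - (linearCost μ A B Q R K₁ w).toReal)
      =O[thresholdDwellRegime] (fun p : ℝ × ℕ => (p.2 : ℝ) ^ (1 / 4 : ℝ) / p.1) := by
  obtain ⟨hfin, t₀, c, hc, hclose⟩ :=
    exists_switchedCost_linearCost_close μ A B Q R K₀ K₁ hK₀ hK₁ W μ₄ w hw
  have hev : ∀ᶠ p : ℝ × ℕ in thresholdDwellRegime, 0 < (p.2 : ℝ) ^ (1 / 4 : ℝ) / p.1 ∧
      switchedCost μ A B Q R K₀ K₁ w p.1 p.2 ≤ linearCost μ A B Q R K₁ w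
        + ENNReal.ofReal (c * ((p.2 : ℝ) ^ (1 / 4 : ℝ) / p.1)) ∧
      linearCost μ A B Q R K₁ w ≤ switchedCost μ A B Q R K₀ K₁ w p.1 p.2
        + ENNReal.ofReal (c * ((p.2 : ℝ) ^ (1 / 4 : ℝ) / p.1)) := by
    filter_upwards [eventually_thresholdDwellRegime t₀] with p ⟨hM, ht1, ht⟩
    have ht0 : (0 : ℝ) < p.2 := by exact_mod_cast ht1
    have hε : 0 < (p.2 : ℝ) ^ (1 / 4 : ℝ) / p.1 := by positivity
    -- Here ε is t^(1/4)/M, the positive solution of t = ε⁴ M⁴.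
    refine ⟨hε, hclose p.2 ht p.1 _ hM hε ?_⟩
    rw [← mul_pow, div_mul_cancel₀ _ hM.ne', ← Real.rpow_natCast, ← Real.rpow_mul ht0.le]
    norm_num
  have hne : ∀ᶠ p : ℝ × ℕ in thresholdDwellRegime,
      switchedCost μ A B Q R K₀ K₁ w p.1 p.2 ≠ ∞ := by
    filter_upwards [hev] with p hp
    exact ne_top_of_le_ne_top (ENNReal.add_ne_top.2 ⟨hfin, ENNReal.ofReal_ne_top⟩) hp.2.1
  refine ⟨hfin, hne, IsBigO.of_bound c ?_⟩
  filter_upwards [hev, hne] with p ⟨hε, h1, h2⟩ hp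
  have hcε : 0 ≤ c * ((p.2 : ℝ) ^ (1 / 4 : ℝ) / p.1) := by positivity
  rw [Real.norm_of_nonneg hε.le, Real.norm_eq_abs, abs_le]
  have h3 := ENNReal.toReal_mono (ENNReal.add_ne_top.2 ⟨hfin, ENNReal.ofReal_ne_top⟩) h1
  have h4 := ENNReal.toReal_mono (ENNReal.add_ne_top.2 ⟨hp, ENNReal.ofReal_ne_top⟩) h2
  rw [ENNReal.toReal_add hfin ENNReal.ofReal_ne_top, ENNReal.toReal_ofReal hcε] at h3
  rw [ENNReal.toReal_add hp ENNReal.ofReal_ne_top, ENNReal.toReal_ofReal hcε] at h4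
  constructor <;> linarith
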